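/- **Setting.** For every $m\ge 1$ let $p_{1,m},\dots,p_{m,m}$ be $[0,1]$-valued random variables ($p$-values) on a probability space $(\Omega_m,\mathcal A_m,P_m)$, and let $\{1,\dots,m\}=I_{0,m}\sqcup I_{1,m}$ be a nonrandom partition into true and false nulls, with $m_j=\#I_{j,m}$. Assume that the vectors $(p_{i,m})_{i\in I_{0,m}}$ and $(p_{i,m})_{i\in I_{1,m}}$ are independent (the dependence within the second is arbitrary) and that the $p_{i,m}$, $i\in I_{0,m}$, are independent and uniformly distributed on $[0,1]$. For $j=0,1$ let $\widehat F_{j,m}(x)=m_j^{-1}\sum_{i\in I_{j,m}}\mathbf 1\{p_{i,m}\le x\}$ (read as $0$ if $m_j=0$), let $\widehat F_m$ be the empirical distribution function of all $m$ $p$-values, and let $R_m(x)=m\widehat F_m(x)$. Fix $0<\alpha<1$ and $\alpha\le\lambda<1$. Let $\widehat m_0=\widehat m_0\big((\widehat F_m(t))_{t\ge\lambda}\big)>0$ be, for each $m$, a measurable function of $(\widehat F_m(t))_{t\ge\lambda}$. The adaptive step-up test has the critical values $\widehat\alpha_{i:m}=\min\{\tfrac{i}{\widehat m_0}\alpha,\lambda\}$,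 $i=0,\dots,m$. With the ordered $p$-values $p_{1:m}\le\dots\le p_{m:m}$ and $p_{0:m}:=0$ it has $$R_m=\max\{i\in\{0,\dots,m\}: p_{i:m}\le\widehat\alpha_{i:m}\}$$ rejections, and it rejects the $i$-th null iff $p_{i,m}\le\widehat\alpha_{R_m:m}$. Let $V_m=\#\{i\in I_{0,m}: p_{i,m}\le\widehat\alpha_{R_m:m}\}$ be the number of false rejections. The tests are called *consistent* if $\frac{V_m}{R_m}-E\big(\frac{V_m}{R_m}\big)\to 0$ in $P_m$-probability as $m\to\infty$, where $\frac00=0$. **Theorem.** Assume that, as $m\to\infty$, * (A1) $m_0/m\to\kappa_0$ for some $\kappa_0\in(0,1]$; * (A3) there is $K>0$ with $\widehat m_0\le Km$ for all $m\ge1$; * (A4) there is a constant $C>1$ with $P_m\big(\widehat m_0\ge\tfrac{C\alpha}{\lambda}\max\{R_m(\lambda),1\}\big)\to1$; * $\widehat m_0/m\to C_0$ in $P_m$-probability for some constant $C_0\in\mathbb R$. Let $\delta>0$ and let $(t_m)_{m\ge1}$ be a sequence in $(0,\lambda)$ with $m\,t_m\to\infty$ and $$P_m\Big(\frac{m_1}{m}\,\frac{\widehat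 F_{1,m}(t_m)}{t_m}\ge\delta-\kappa_0+\frac{C_0}{\alpha}\Big)\to1 .$$ Then $V_m\to\infty$ in $P_m$-probability, that is, $P_m(V_m>x)\to1$ for every $x\in\mathbb R$, and the tests are consistent. -/

import Mathlib

open MeasureTheory ProbabilityTheory Filter Topology

noncomputable section

namespace StepUp

/-- Convergence in `P m`-probability, as `m → ∞`, of real random variables `X m`, each living on its
own probability space, to a constant `c`. -/
def TendstoInProb {Ω : ℕ → Type*} [∀ m, MeasurableSpace (Ω m)] (P : ∀ m, Measure (Ω m))
    (X : ∀ m, Ω m → ℝ) (c : ℝ) : Prop :=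
  ∀ ε : ℝ, 0 < ε → Tendsto (fun m => P m {ω | ε ≤ |X m ω - c|}) atTop (𝓝 0)

/-- Divergence to `∞` in `P m`-probability, as `m → ∞`. -/
def TendstoInftyInProb {Ω : ℕ → Type*} [∀ m, MeasurableSpace (Ω m)] (P : ∀ m, Measure (Ω m))
    (X : ∀ m, Ω m → ℝ) : Prop :=
  ∀ x : ℝ, Tendsto (fun m => P m {ω | x < X m ω}) atTop (𝓝 1)

/-- The basic independence model for `m` p-values `p i`, where `I₀` is the set of true nulls and its
complement is the set of false nulls. -/
structure BasicIndependence {m : ℕ} {Ω : Type*} [MeasurableSpace Ω] (P : Measure Ω)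
    (p : Fin m → Ω → ℝ) (I₀ : Finset (Fin m)) : Prop where
  measurable : ∀ i, Measurable (p i)
  mem_Icc : ∀ i ω, p i ω ∈ Set.Icc (0 : ℝ) 1
  /-- The vector of true-null p-values is independent of the vector of false-null p-values. -/
  indep_true_false :
    IndepFun (fun ω (i : {i // i ∈ I₀}) => p i ω) (fun ω (i : {i // i ∉ I₀}) => p i ω) P
  /-- The true-null p-values are independent. -/
  indep_true : iIndepFun (fun (i : {i // i ∈ I₀}) => p i) P
  /-- The true-null p-values are uniformly distributed on `[0, 1]`. -/
  uniform_true : ∀ i ∈ I₀, ∀ x ∈ Set.Icc (0 : ℝ) 1, P {ω | p i ω ≤ x} = ENNReal.ofReal x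

/-- Number of indices in `S` with `x i ≤ t`. -/
def countLE {m : ℕ} (x : Fin m → ℝ) (S : Finset (Fin m)) (t : ℝ) : ℕ :=
  (S.filter fun i => x i ≤ t).card

/-- Empirical distribution function, at `t`, of the values `x i`, `i ∈ S`
(`0` if `S` is empty). -/
def ecdf {m : ℕ} (x : Fin m → ℝ) (S : Finset (Fin m)) (t : ℝ) : ℝ :=
  (countLE x S t : ℝ) / (S.card : ℝ)

/-- The estimator `m̂₀`: a function `est` of the restriction to `[lam, ∞)` of the empirical
distribution function of all p-values. -/
def mHat {m : ℕ} (lam : ℝ) (est : (Set.Ici lam → ℝ) → ℝ) (x : Fin m → ℝ) : ℝ :=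
  est fun t => ecdf x Finset.univ t

/-- The `i`-th smallest of the values `x 1, …, x m` for `1 ≤ i ≤ m`; it is `0` for `i = 0`
(and for the irrelevant `i > m`). -/
def orderStat {m : ℕ} (x : Fin m → ℝ) (i : ℕ) : ℝ :=
  if h : 0 < i ∧ i ≤ m then x (Tuple.sort x ⟨i - 1, by omega⟩) else 0

/-- The data driven critical values `min {(i / m̂₀) α, lam}`; the value at `i = 0` is `0`
for `lam ≥ 0`. -/
def critVal (α lam mhat : ℝ) (i : ℕ) : ℝ := min ((i : ℝ) / mhat * α) lam

open Classical in
/-- Number of rejections of the step-up test with critical values `c`: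
the largest `i ∈ {0, …, m}` such that the `i`-th order statistic is at most `c i`. -/
def numReject {m : ℕ} (x : Fin m → ℝ) (c : ℕ → ℝ) : ℕ :=
  Nat.findGreatest (fun i => orderStat x i ≤ c i) m

/-- Number of rejections `R_m` of the adaptive step-up test. -/
def R {m : ℕ} (α lam : ℝ) (est : (Set.Ici lam → ℝ) → ℝ) (x : Fin m → ℝ) : ℕ :=
  numReject x (critVal α lam (mHat lam est x))

/-- Number of false rejections `V_m` of the adaptive step-up test: the `i`-th null is rejected iff
`x i` is at most the critical value with index `R_m`. -/
def V {m : ℕ} (α lam : ℝ) (est : (Set.Ici lam → ℝ) → ℝ) (I₀ : Finset (Fin m))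
    (x : Fin m → ℝ) : ℕ :=
  countLE x I₀ (critVal α lam (mHat lam est x) (R α lam est x))

/-- The false discovery proportion `V_m / R_m`, with `0 / 0 = 0`. -/
def FDP {m : ℕ} (α lam : ℝ) (est : (Set.Ici lam → ℝ) → ℝ) (I₀ : Finset (Fin m))
    (x : Fin m → ℝ) : ℝ :=
  (V α lam est I₀ x : ℝ) / (R α lam est x : ℝ)

/-- Consistency of the tests: `V_m / R_m - E (V_m / R_m) → 0` in `P m`-probability. -/
def Consistent {Ω : ℕ → Type*} [∀ m, MeasurableSpace (Ω m)] (P : ∀ m, Measure (Ω m))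
    (p : ∀ m, Fin m → Ω m → ℝ) (I₀ : ∀ m, Finset (Fin m)) (α lam : ℝ)
    (est : ℕ → (Set.Ici lam → ℝ) → ℝ) : Prop :=
  TendstoInProb P
    (fun m ω => FDP α lam (est m) (I₀ m) (fun i => p m i ω)
      - ∫ ω', FDP α lam (est m) (I₀ m) (fun i => p m i ω') ∂(P m)) 0

end StepUp

end

/-! Let `s` be the random threshold of the test. Under (A4) it is not truncated at `lam`, so `s = R
α / m̂₀`, and solving for `R` gives `V / R = α / (m̂₀/m) * (m₀/m) * (F̂₀(s) / s)` (`critVal_R_eq`,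
`FDP_eq`). The first two factors converge by assumption; `C₀ > 0` follows from (A4) and the law of
large numbers at `lam`.

For the last factor, `F̂₀(s) / s → 1` uniformly over `[t_m, lam]`, because `m₀ t_m → ∞`: Chebyshev
on a geometric grid starting at `t_m` has summable error bounds, and monotonicity interpolates
(`eventually_abs_countLE_sub_le`). Uniformity allows a random `s` that depends on all p-values.

The condition on `F̂₁(t_m)` puts the ecdf of all p-values above the line of slope `m̂₀ / (α m)` at
`t_m`, which forces `s ≥ t_m` (`le_critVal_R`). Hence `V ≥ m₀ F̂₀(t_m) → ∞`, and `V / R → α κ₀ / C₀`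
in probability. Since `0 ≤ V / R ≤ 1`, its expectation has the same limit. -/

namespace StepUp

/-! ### Step-up tests for fixed p-values -/

section Deterministic

variable {m : ℕ}

lemma countLE_mono (x : Fin m → ℝ) (S : Finset (Fin m)) : Monotone (countLE x S) :=
  fun _ _ h => Finset.card_le_card (Finset.monotone_filter_right _ fun _ _ hi => hi.trans h)

lemma countLE_le (x : Fin m → ℝ) (S : Finset (Fin m)) (s : ℝ) : countLE x S s ≤ m :=
  (Finset.card_filter_le _ _).trans (card_finset_fin_le S)

lemma countLE_le_univ (x : Fin m → ℝ) (S : Finset (Fin m)) (s : ℝ) :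
    countLE x S s ≤ countLE x Finset.univ s :=
  Finset.card_le_card (Finset.filter_subset_filter _ (Finset.subset_univ S))

lemma countLE_add_compl (x : Fin m → ℝ) (S : Finset (Fin m)) (s : ℝ) :
    countLE x S s + countLE x Sᶜ s = countLE x Finset.univ s := by
  unfold countLE
  rw [← Finset.card_union_of_disjoint, ← Finset.filter_union, Finset.union_compl]
  exact Finset.disjoint_filter_filter disjoint_compl_right

lemma card_mul_ecdf (x : Fin m → ℝ) (S : Finset (Fin m)) (s : ℝ) :
    (S.card : ℝ) * ecdf x S s = countLE x S s := by
  unfold ecdf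
  rcases S.eq_empty_or_nonempty with rfl | h
  · simp [countLE]
  · exact mul_div_cancel₀ _ (by simpa using h.ne_empty)

/-- After sorting, the values at most `c` occupy an initial segment, and the sorting permutation
preserves their number. -/
lemma orderStat_le_iff (x : Fin m → ℝ) {i : ℕ} (hi : 0 < i) (him : i ≤ m) (c : ℝ) :
    orderStat x i ≤ c ↔ i ≤ countLE x Finset.univ c := by
  have h := Tuple.lt_card_le_iff_apply_le_of_monotone (f := x ∘ Tuple.sort x) (a := c)
    (j := ⟨i - 1, by omega⟩) (Tuple.monotone_sort x)
  have hc : (Finset.univ.filter fun j => (x ∘ Tuple.sort x) j ≤ c).card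
      = countLE x Finset.univ c := by
    unfold countLE
    refine Finset.card_bij (fun j _ => Tuple.sort x j) (by simp) (by simp) fun b hb => ?_
    exact ⟨(Tuple.sort x).symm b, by simpa using hb, by simp⟩
  rw [hc] at h
  rw [orderStat, dif_pos ⟨hi, him⟩]
  simp only [Function.comp_apply] at h
  rw [← h]
  omega

lemma orderStat_le_iff' (x : Fin m → ℝ) {c : ℕ → ℝ} (h0 : 0 ≤ c 0) {i : ℕ} (him : i ≤ m) :
    orderStat x i ≤ c i ↔ i ≤ countLE x Finset.univ (c i) := by
  rcases Nat.eq_zero_or_pos i with rfl | hi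
  · simpa [orderStat] using h0
  · exact orderStat_le_iff x hi him _

lemma numReject_le (x : Fin m → ℝ) (c : ℕ → ℝ) : numReject x c ≤ m :=
  Nat.findGreatest_le _

lemma le_numReject (x : Fin m → ℝ) {c : ℕ → ℝ} (h0 : 0 ≤ c 0) {i : ℕ} (him : i ≤ m)
    (h : i ≤ countLE x Finset.univ (c i)) : i ≤ numReject x c :=
  Nat.le_findGreatest him ((orderStat_le_iff' x h0 him).2 h)

/-- Self-consistency: since `c` is monotone, a count exceeding the number of rejections would itself
be an admissible larger index. -/
lemma countLE_numReject (x : Fin m → ℝ) {c : ℕ → ℝ} (h0 : 0 ≤ c 0) (hc : Monotone c) :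
    countLE x Finset.univ (c (numReject x c)) = numReject x c := by
  classical
  have hle : numReject x c ≤ countLE x Finset.univ (c (numReject x c)) := by
    rw [← orderStat_le_iff' x h0 (numReject_le x c)]
    exact Nat.findGreatest_spec (P := fun i => orderStat x i ≤ c i) (Nat.zero_le m)
      (by simpa [orderStat] using h0)
  exact le_antisymm (le_numReject x h0 (countLE_le _ _ _) (countLE_mono _ _ (hc hle))) hle

variable {α lam : ℝ} {est : (Set.Ici lam → ℝ) → ℝ} {x : Fin m → ℝ}

lemma critVal_mono (hα : 0 ≤ α) (lam : ℝ) {M : ℝ} (hM : 0 ≤ M) : Monotone (critVal α lam M) :=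
  fun i j h => min_le_min_right _ (by gcongr)

lemma critVal_zero (hlam : 0 ≤ lam) (M : ℝ) : critVal α lam M 0 = 0 := by
  simp [critVal, hlam]

lemma countLE_R (hα : 0 ≤ α) (hlam : 0 ≤ lam) (hM : 0 < mHat lam est x) :
    countLE x Finset.univ (critVal α lam (mHat lam est x) (R α lam est x)) = R α lam est x :=
  countLE_numReject x (critVal_zero hlam _).ge (critVal_mono hα lam hM.le)

lemma V_le_R (hα : 0 ≤ α) (hlam : 0 ≤ lam) (hM : 0 < mHat lam est x) (I₀ : Finset (Fin m)) :
    V α lam est I₀ x ≤ R α lam est x :=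
  (countLE_le_univ _ _ _).trans (countLE_R hα hlam hM).le

lemma FDP_nonneg (I₀ : Finset (Fin m)) : 0 ≤ FDP α lam est I₀ x := by
  unfold FDP; positivity

lemma FDP_le_one (hα : 0 ≤ α) (hlam : 0 ≤ lam) (hM : 0 < mHat lam est x) (I₀ : Finset (Fin m)) :
    FDP α lam est I₀ x ≤ 1 :=
  div_le_one_of_le₀ (by exact_mod_cast V_le_R hα hlam hM I₀) (by positivity)

/-- If the line `s ↦ s * m̂₀ / α` is below the number of p-values `≤ s` at `s`, then the step-up
test has a threshold of at least `s`. -/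
lemma le_critVal_R (hα : 0 ≤ α) (hM : 0 < mHat lam est x) {s : ℝ} (hs : 0 ≤ s) (hsl : s ≤ lam)
    (h : s * mHat lam est x ≤ countLE x Finset.univ s * α) :
    s ≤ critVal α lam (mHat lam est x) (R α lam est x) := by
  have h1 : s ≤ critVal α lam (mHat lam est x) (countLE x Finset.univ s) := by
    refine le_min ?_ hsl
    rw [div_mul_eq_mul_div, le_div_iff₀ hM]
    exact h
  exact h1.trans (critVal_mono hα lam hM.le
    (le_numReject x (critVal_zero (hs.trans hsl) _).ge (countLE_le _ _ _) (countLE_mono _ _ h1)))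

/-- The threshold of the step-up test is not truncated at `lam` if `m̂₀` is large enough. -/
lemma critVal_R_eq (hα : 0 < α) (hlam : 0 < lam) (hM : 0 < mHat lam est x) {C : ℝ} (hC : 1 < C)
    (h : C * α / lam * max (countLE x Finset.univ lam : ℝ) 1 ≤ mHat lam est x) :
    critVal α lam (mHat lam est x) (R α lam est x) = R α lam est x / mHat lam est x * α := by
  refine min_eq_left ?_
  -- The threshold never exceeds `lam`, so neither does any rejected p-value.
  have hR : (R α lam est x : ℝ) ≤ countLE x Finset.univ lam := by
    rw [← countLE_R hα.le hlam.le hM]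
    exact_mod_cast countLE_mono _ _ (min_le_right _ _)
  rw [div_mul_eq_mul_div, div_le_iff₀ hM]
  have h2 : C * α / lam * (R α lam est x : ℝ) ≤ mHat lam est x :=
    le_trans (by gcongr; exact hR.trans (le_max_left _ _)) h
  rw [div_mul_eq_mul_div, div_le_iff₀ hlam] at h2
  have : (R α lam est x : ℝ) * α ≤ C * α * R α lam est x := by
    have : 0 ≤ α * (R α lam est x : ℝ) := by positivity
    nlinarith
  linarith

lemma FDP_eq (hα : 0 < α) (hM : 0 < mHat lam est x) (I₀ : Finset (Fin m)) {s : ℝ} (hs : 0 < s)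
    (h1 : critVal α lam (mHat lam est x) (R α lam est x) = s)
    (h2 : s = R α lam est x / mHat lam est x * α) :
    FDP α lam est I₀ x = α / mHat lam est x * (countLE x I₀ s / s) := by
  have hR : (R α lam est x : ℝ) = s * mHat lam est x / α := by
    rw [h2]; field_simp
  rw [FDP, V, h1, hR]
  field_simp

end Deterministic

/-! ### Measurability of the test -/

section Measurability

variable {m : ℕ} {Ω : Type*} [MeasurableSpace Ω] {p : Fin m → Ω → ℝ}

lemma measurable_countLE (hp : ∀ i, Measurable (p i)) (S : Finset (Fin m)) {c : Ω → ℝ}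
    (hc : Measurable c) : Measurable fun ω => countLE (fun i => p i ω) S (c ω) := by
  simp only [countLE, Finset.card_filter]
  exact Finset.measurable_sum _ fun i _ =>
    Measurable.ite (measurableSet_le (hp i) hc) measurable_const measurable_const

lemma measurable_mHat (hp : ∀ i, Measurable (p i)) {lam : ℝ} {est : (Set.Ici lam → ℝ) → ℝ}
    (hest : Measurable est) : Measurable fun ω => mHat lam est fun i => p i ω := by
  refine hest.comp (measurable_pi_lambda _ fun t => ?_)
  exact (measurable_from_top.comp (measurable_countLE hp Finset.univ measurable_const)).div_const _

variable {α lam : ℝ} {est : (Set.Ici lam → ℝ) → ℝ}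

lemma measurable_critVal (hp : ∀ i, Measurable (p i)) (hest : Measurable est) {r : Ω → ℕ}
    (hr : Measurable r) :
    Measurable fun ω => critVal α lam (mHat lam est fun i => p i ω) (r ω) :=
  (((measurable_from_top.comp hr).div (measurable_mHat hp hest)).mul_const α).min measurable_const

lemma measurable_R (hp : ∀ i, Measurable (p i)) (hest : Measurable est) (hlam : 0 ≤ lam) :
    Measurable fun ω => R α lam est fun i => p i ω := by
  classical
  refine measurable_findGreatest (p := fun ω i => orderStat (fun i => p i ω) i
    ≤ critVal α lam (mHat lam est fun i => p i ω) i) fun k hk => ?_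
  simp only [orderStat_le_iff' _ (critVal_zero hlam _).ge hk]
  exact measurableSet_le measurable_const
    (measurable_countLE hp _ (measurable_critVal hp hest measurable_const))

lemma measurable_FDP (hp : ∀ i, Measurable (p i)) (hest : Measurable est) (hlam : 0 ≤ lam)
    (I₀ : Finset (Fin m)) : Measurable fun ω => FDP α lam est I₀ fun i => p i ω :=
  (measurable_from_top.comp (measurable_countLE hp _
    (measurable_critVal hp hest (measurable_R hp hest hlam)))).div
    (measurable_from_top.comp (measurable_R hp hest hlam))

end Measurability

/-! ### Chebyshev bounds on a geometric grid -/

section Chebyshev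

variable {m : ℕ} {Ω : Type*} [MeasurableSpace Ω] {P : Measure Ω} [IsProbabilityMeasure P]
  {p : Fin m → Ω → ℝ} {I₀ : Finset (Fin m)}

lemma BasicIndependence.measure_le (h : BasicIndependence P p I₀) {s : ℝ}
    (hs : s ∈ Set.Icc (0 : ℝ) 1) {η : ℝ} (hη : 0 < η) :
    P {ω | η ≤ |(countLE (fun i => p i ω) I₀ s : ℝ) - I₀.card * s|}
      ≤ ENNReal.ofReal (I₀.card * s / η ^ 2) := by
  set X : {i // i ∈ I₀} → Ω → ℝ := fun i => Set.indicator (p i ⁻¹' Set.Iic s) 1 with hX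
  have hmeas : ∀ i, MeasurableSet (p i ⁻¹' Set.Iic s) := fun i => h.measurable i measurableSet_Iic
  have hL : ∀ i, MemLp (X i) 2 P := fun i =>
    memLp_indicator_const 2 (hmeas _) 1 (Or.inr (measure_ne_top _ _))
  have hreal : ∀ i : {i // i ∈ I₀}, P.real (p i ⁻¹' Set.Iic s) = s := fun i => by
    rw [Measure.real]
    exact (congrArg ENNReal.toReal (h.uniform_true i i.2 s hs)).trans (ENNReal.toReal_ofReal hs.1)
  have hE : ∀ i, ∫ ω, X i ω ∂P = s := fun i => by
    rw [hX, integral_indicator_one (hmeas _), hreal]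
  -- The variance is at most the second moment, and an indicator equals its square.
  have hVar : ∀ i, Var[X i; P] ≤ s := fun i => by
    refine (variance_le_expectation_sq (hL i).1).trans_eq ?_
    rw [← hE i]
    congr 1
    ext ω
    by_cases hω : ω ∈ p i ⁻¹' Set.Iic s <;> simp [hX, hω, Set.indicator]
  have hind : iIndepFun X P := by
    have := h.indep_true.comp (fun _ => Set.indicator (Set.Iic s) (1 : ℝ → ℝ))
      (fun _ => measurable_one.indicator measurableSet_Iic)
    exact this
  have hsum : ∀ ω, (∑ i, X i) ω = countLE (fun i => p i ω) I₀ s := fun ω => by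
    rw [countLE, Finset.card_filter, Finset.sum_apply, ← Finset.sum_coe_sort I₀]
    push_cast
    rfl
  have hEs : ∫ ω, (∑ i, X i) ω ∂P = I₀.card * s := by
    simp only [Finset.sum_apply]
    rw [integral_finsetSum _ fun i _ => (hL i).integrable (by norm_num)]
    simp [hE]
  have hVs : Var[∑ i, X i; P] ≤ I₀.card * s := by
    rw [IndepFun.variance_sum (fun i _ => hL i) fun i _ j _ hij => hind.indepFun hij]
    refine (Finset.sum_le_sum fun i _ => hVar i).trans_eq ?_
    simp
  have := meas_ge_le_variance_div_sq (memLp_finsetSum' Finset.univ fun i _ => hL i) hη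
  rw [hEs] at this
  simp only [hsum] at this
  exact this.trans (ENNReal.ofReal_le_ofReal (by gcongr))

/-- Outside an event of probability `O(1 / (m₀ t))`, the empirical distribution function of the
true nulls is close to the identity on the geometric grid `t q ^ k`, relative to the identity. -/
lemma BasicIndependence.measure_grid_le (h : BasicIndependence P p I₀) (hI : 0 < I₀.card)
    {t : ℝ} (ht : 0 < t) {q : ℝ} (hq : 1 < q) {η : ℝ} (hη : 0 < η) :
    P {ω | ∃ k : ℕ, t * q ^ k ≤ 1 ∧ η * (I₀.card * (t * q ^ k)) ≤
        |(countLE (fun i => p i ω) I₀ (t * q ^ k) : ℝ) - I₀.card * (t * q ^ k)|}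
      ≤ ENNReal.ofReal (1 / (η ^ 2 * (I₀.card * t)) * (1 - q⁻¹)⁻¹) := by
  have hc : (0 : ℝ) < I₀.card := by exact_mod_cast hI
  have hq0 : 0 < q := by linarith
  have hqi : q⁻¹ < 1 := inv_lt_one_of_one_lt₀ hq
  -- Chebyshev at `t q ^ k` gives `1 / (η² m₀ t q ^ k)`, so the union bound is a geometric series in
  -- `q⁻¹`.
  rw [← tsum_geometric_of_lt_one (inv_nonneg.2 hq0.le) hqi, ← tsum_mul_left,
    ENNReal.ofReal_tsum_of_nonneg (fun k => by positivity)
      ((summable_geometric_of_lt_one (inv_nonneg.2 hq0.le) hqi).mul_left _),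
    Set.ofPred_exists]
  refine (measure_iUnion_le _).trans (ENNReal.tsum_le_tsum fun k => ?_)
  by_cases hk : t * q ^ k ≤ 1
  · refine (measure_mono fun ω hω => hω.2).trans
      ((h.measure_le ⟨by positivity, hk⟩ (by positivity)).trans_eq ?_)
    congr 1
    rw [inv_pow]
    field_simp
  · simp [hk]

/-- An interpolation between the points of a geometric grid. -/
lemma abs_countLE_sub_le (x : Fin m → ℝ) (S : Finset (Fin m)) {t lam η : ℝ} (ht : 0 < t)
    (hη : 0 < η) (hη1 : η ≤ 1) (hlam : (1 + η) * lam ≤ 1)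
    (h : ∀ k : ℕ, t * (1 + η) ^ k ≤ 1 →
      |(countLE x S (t * (1 + η) ^ k) : ℝ) - S.card * (t * (1 + η) ^ k)|
        ≤ η * (S.card * (t * (1 + η) ^ k)))
    {s : ℝ} (hs : s ∈ Set.Icc t lam) :
    |(countLE x S s : ℝ) - S.card * s| ≤ 3 * η * (S.card * s) := by
  -- Neighbouring grid points: `t (1 + η) ^ k ≤ s < t (1 + η) ^ (k + 1)`.
  obtain ⟨k, hk1, hk2⟩ := exists_nat_pow_near ((one_le_div ht).2 hs.1) (lt_add_of_pos_right 1 hη)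
  rw [le_div_iff₀' ht] at hk1
  rw [div_lt_iff₀' ht] at hk2
  have hs0 : 0 < s := ht.trans_le hs.1
  have hup : t * (1 + η) ^ (k + 1) ≤ (1 + η) * s := by
    rw [pow_succ]; nlinarith
  have h1 : t * (1 + η) ^ (k + 1) ≤ 1 := hup.trans (le_trans (by gcongr; exact hs.2) hlam)
  have h0 : t * (1 + η) ^ k ≤ 1 :=
    hk1.trans (by nlinarith [hs.2])
  have a1 := (abs_le.1 (h _ h1)).2
  have a0 := (abs_le.1 (h _ h0)).1
  have c1 : (countLE x S s : ℝ) ≤ countLE x S (t * (1 + η) ^ (k + 1)) := by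
    exact_mod_cast countLE_mono x S hk2.le
  have c0 : (countLE x S (t * (1 + η) ^ k) : ℝ) ≤ countLE x S s := by
    exact_mod_cast countLE_mono x S hk1
  have hn : (0 : ℝ) ≤ S.card := by positivity
  have hns : 0 ≤ (S.card : ℝ) * s := by positivity
  have u1 : (S.card : ℝ) * (t * (1 + η) ^ (k + 1)) ≤ S.card * ((1 + η) * s) := by gcongr
  have u0 : (1 - η) * (S.card * s) ≤ S.card * (t * (1 + η) ^ k) := by
    have e : s ≤ (1 + η) * (t * (1 + η) ^ k) := by rw [pow_succ] at hk2; linarith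
    have : (1 - η) * s ≤ t * (1 + η) ^ k := by
      have e2 : (1 - η) * s ≤ (1 - η) * ((1 + η) * (t * (1 + η) ^ k)) :=
        mul_le_mul_of_nonneg_left e (by linarith)
      have : 0 ≤ η ^ 2 * (t * (1 + η) ^ k) := by positivity
      nlinarith
    nlinarith
  -- The constant 3 comes from `(1 + η)² ≤ 1 + 3η`, as `η ≤ 1`, and `(1 - η)² ≥ 1 - 3η`.
  have e2 : 0 ≤ η * (S.card * s) := by positivity
  have e3 : η * (η * (S.card * s)) ≤ 1 * (η * (S.card * s)) := by gcongr
  rw [abs_le]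
  constructor
  · have := mul_le_mul_of_nonneg_left u0 (by linarith : 0 ≤ 1 - η)
    nlinarith
  · have := mul_le_mul_of_nonneg_left u1 (by linarith : 0 ≤ 1 + η)
    nlinarith

end Chebyshev

/-! ### Convergence in probability as convergence along a filter -/

section WHP

variable {Ω : ℕ → Type*} [∀ m, MeasurableSpace (Ω m)]

/-- The filter of the events that hold with probability tending to one. -/
def whp (P : ∀ m, Measure (Ω m)) : Filter (Σ m, Ω m) where
  sets := {S | Tendsto (fun m => P m {ω | (⟨m, ω⟩ : Σ m, Ω m) ∉ S}) atTop (𝓝 0)}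
  univ_sets := by simp
  sets_of_superset {S T} hS hST := tendsto_of_tendsto_of_tendsto_of_le_of_le tendsto_const_nhds hS
    (fun _ => zero_le) fun m => measure_mono fun _ hω h => hω (hST h)
  inter_sets {S T} hS hT := by
    have := Tendsto.add hS hT
    rw [add_zero] at this
    refine tendsto_of_tendsto_of_tendsto_of_le_of_le tendsto_const_nhds this
      (fun _ => zero_le) fun m => (measure_mono fun ω hω => ?_).trans (measure_union_le _ _)
    simp only [Set.mem_inter_iff, Set.mem_ofPred_eq, not_and_or] at hω
    exact hω

variable {P : ∀ m, Measure (Ω m)}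

lemma eventually_whp {q : (Σ m, Ω m) → Prop} :
    (∀ᶠ z in whp P, q z) ↔ Tendsto (fun m => P m {ω | ¬ q ⟨m, ω⟩}) atTop (𝓝 0) := Iff.rfl

lemma tendsto_fst_whp : Tendsto Sigma.fst (whp P) atTop := by
  rw [tendsto_atTop]
  intro n
  rw [eventually_whp]
  refine tendsto_const_nhds.congr' ?_
  filter_upwards [eventually_ge_atTop n] with m hm
  simp [hm]

lemma eventually_whp_of_le {q : (Σ m, Ω m) → Prop} {u : ℕ → ENNReal}
    (hu : Tendsto u atTop (𝓝 0)) (h : ∀ᶠ m in atTop, P m {ω | ¬ q ⟨m, ω⟩} ≤ u m) :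
    ∀ᶠ z in whp P, q z :=
  eventually_whp.2 (tendsto_of_tendsto_of_tendsto_of_le_of_le' tendsto_const_nhds hu
    (Eventually.of_forall fun _ => zero_le) h)

lemma tendstoInProb_iff {X : ∀ m, Ω m → ℝ} {c : ℝ} :
    TendstoInProb P X c ↔ Tendsto (fun z : Σ m, Ω m => X z.1 z.2) (whp P) (𝓝 c) := by
  rw [Metric.tendsto_nhds]
  simp only [eventually_whp, Real.dist_eq, not_lt]
  rfl

variable [∀ m, IsProbabilityMeasure (P m)]

/-- Needed to compare limits along `whp P`; the empty event cannot have probability tending to one.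
-/
instance : (whp P).NeBot := by
  refine ⟨fun h => ?_⟩
  have : ∀ᶠ z in whp P, False := by rw [h]; exact eventually_bot
  rw [eventually_whp] at this
  simp at this

lemma eventually_whp_of_tendsto_one {q : (Σ m, Ω m) → Prop}
    (hq : ∀ᶠ m in atTop, MeasurableSet {ω | q ⟨m, ω⟩})
    (h : Tendsto (fun m => P m {ω | q ⟨m, ω⟩}) atTop (𝓝 1)) : ∀ᶠ z in whp P, q z := by
  have := ENNReal.Tendsto.sub (tendsto_const_nhds (x := 1)) h (Or.inl ENNReal.one_ne_top)
  rw [tsub_self] at this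
  refine eventually_whp_of_le this ?_
  filter_upwards [hq] with m hm
  exact (prob_compl_eq_one_sub hm).le

lemma tendsto_one_of_eventually_whp {q : (Σ m, Ω m) → Prop} (h : ∀ᶠ z in whp P, q z) :
    Tendsto (fun m => P m {ω | q ⟨m, ω⟩}) atTop (𝓝 1) := by
  have := ENNReal.Tendsto.sub (tendsto_const_nhds (x := 1)) (eventually_whp.1 h)
    (Or.inl ENNReal.one_ne_top)
  rw [tsub_zero] at this
  refine tendsto_of_tendsto_of_tendsto_of_le_of_le this tendsto_const_nhds (fun m => ?_)
    fun m => prob_le_one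
  rw [tsub_le_iff_right, ← measure_univ (μ := P m)]
  refine (measure_mono fun ω _ => ?_).trans (measure_union_le _ _)
  exact em _

/-- Dominated convergence for uniformly bounded random variables that converge in probability. -/
lemma tendsto_integral_of_tendsto_whp {X : ∀ m, Ω m → ℝ} {c b : ℝ}
    (hX : ∀ᶠ m in atTop, Measurable (X m)) (hb : ∀ᶠ m in atTop, ∀ ω, |X m ω| ≤ b)
    (h : Tendsto (fun z : Σ m, Ω m => X z.1 z.2) (whp P) (𝓝 c)) :
    Tendsto (fun m => ∫ ω, X m ω ∂(P m)) atTop (𝓝 c) := by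
  rw [Metric.tendsto_nhds]
  intro ε hε
  have h1 := (tendstoInProb_iff.2 h) (ε / 3) (by positivity)
  have hB : 0 < |b| + |c| + 1 := by positivity
  have h2 : ∀ᶠ m in atTop, (P m).real {ω | ε / 3 ≤ |X m ω - c|} < ε / 3 / (|b| + |c| + 1) := by
    have := (ENNReal.tendsto_toReal ENNReal.zero_ne_top).comp h1
    exact this.eventually_lt_const (by simp; positivity)
  filter_upwards [hX, hb, h2] with m hm hbm h2m
  have hint : Integrable (X m) (P m) :=
    Integrable.of_bound hm.aestronglyMeasurable b (Eventually.of_forall hbm)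
  set A : Set (Ω m) := {ω | ε / 3 ≤ |X m ω - c|} with hA
  have hAm : MeasurableSet A := measurableSet_le measurable_const (by fun_prop)
  have hd : ∫ ω, X m ω ∂(P m) - c = ∫ ω, (X m ω - c) ∂(P m) := by
    rw [integral_sub hint (integrable_const c)]; simp
  rw [Real.dist_eq, hd]
  -- The integrand is below `ε / 3` off `A` and at most `|b| + |c|` on `A`; the extra 1 keeps the
  -- divisor in `h2` positive.
  calc |∫ ω, (X m ω - c) ∂(P m)| ≤ ∫ ω, |X m ω - c| ∂(P m) := abs_integral_le_integral_abs
    _ ≤ ∫ ω, (ε / 3 + A.indicator (fun _ => |b| + |c| + 1) ω) ∂(P m) := by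
        refine integral_mono (hint.sub (integrable_const c)).abs
          ((integrable_const _).add ((integrable_const _).indicator hAm)) fun ω => ?_
        by_cases hω : ω ∈ A
        · simp only [hω, Set.indicator_of_mem]
          have := abs_sub (X m ω) c
          have := hbm ω
          have := le_abs_self b
          linarith
        · simp only [hω, not_false_eq_true, Set.indicator_of_notMem, add_zero]
          exact (not_le.1 hω).le
    _ = ε / 3 + (P m).real A * (|b| + |c| + 1) := by
        rw [integral_add (integrable_const _) ((integrable_const _).indicator hAm),
          integral_indicator_const _ hAm]
        simp
    _ < ε := by
        rw [lt_div_iff₀ hB] at h2m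
        linarith

end WHP

/-! ### Measurability of the events in the hypotheses -/

section Events

variable {m : ℕ} {Ω : Type*} [MeasurableSpace Ω] {p : Fin m → Ω → ℝ}

lemma measurable_cast_countLE (hp : ∀ i, Measurable (p i)) (S : Finset (Fin m)) (s : ℝ) :
    Measurable fun ω => (countLE (fun i => p i ω) S s : ℝ) :=
  measurable_from_top.comp (measurable_countLE hp S measurable_const)

lemma measurableSet_le_mHat (hp : ∀ i, Measurable (p i)) {lam : ℝ}
    {est : (Set.Ici lam → ℝ) → ℝ} (hest : Measurable est) (c : ℝ) :
    MeasurableSet {ω | c * max (countLE (fun i => p i ω) Finset.univ lam : ℝ) 1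
      ≤ mHat lam est fun i => p i ω} := by
  have h1 := measurable_cast_countLE hp Finset.univ lam
  have h2 := measurable_mHat hp hest
  exact measurableSet_le ((h1.max measurable_const).const_mul c) h2

lemma measurableSet_le_ecdf (hp : ∀ i, Measurable (p i)) (S : Finset (Fin m)) (a b s : ℝ) :
    MeasurableSet {ω | a ≤ b * (ecdf (fun i => p i ω) S s / s)} := by
  have h1 := measurable_cast_countLE hp S s
  exact measurableSet_le measurable_const (((h1.div_const _).div_const s).const_mul b)

end Events

/-! ### Uniform relative law of large numbers -/

section Uniform

variable {Ω : ℕ → Type*} [∀ m, MeasurableSpace (Ω m)] {P : ∀ m, Measure (Ω m)}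
  [∀ m, IsProbabilityMeasure (P m)] {p : ∀ m, Fin m → Ω m → ℝ} {I₀ : ∀ m, Finset (Fin m)}
  {t : ℕ → ℝ} {lam : ℝ}

/-- The empirical distribution function of the true nulls is, relative to the identity, uniformly
close to the identity on `[t m, lam]`. -/
theorem eventually_abs_countLE_sub_le (hBI : ∀ m, 0 < m → BasicIndependence (P m) (p m) (I₀ m))
    (hlam0 : 0 < lam) (hlam1 : lam < 1) (ht : ∀ m, 0 < m → t m ∈ Set.Ioo 0 lam)
    (htm : Tendsto (fun m => ((I₀ m).card : ℝ) * t m) atTop atTop) {ε : ℝ} (hε : 0 < ε) :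
    ∀ᶠ z : Σ m, Ω m in whp P, ∀ s ∈ Set.Icc (t z.1) lam,
      |(countLE (fun i => p z.1 i z.2) (I₀ z.1) s : ℝ) - (I₀ z.1).card * s|
        ≤ ε * ((I₀ z.1).card * s) := by
  -- `ε / 3` absorbs the interpolation factor 3; `1 - lam` gives `(1 + η) lam ≤ 1`, so the grid
  -- point above any `s ≤ lam` stays in `[0, 1]`.
  set η : ℝ := min (ε / 3) (1 - lam) with hη
  have hη0 : 0 < η := lt_min (by positivity) (by linarith)
  have hη1 : η ≤ 1 - lam := min_le_right _ _
  have hηε : 3 * η ≤ ε := by have := min_le_left (ε / 3) (1 - lam); linarith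
  have hl : (1 + η) * lam ≤ 1 := by nlinarith
  have hu : Tendsto (fun m => ENNReal.ofReal
      (1 / (η ^ 2 * ((I₀ m).card * t m)) * (1 - (1 + η)⁻¹)⁻¹)) atTop (𝓝 0) := by
    have h1 : Tendsto (fun m => 1 / (η ^ 2 * ((I₀ m).card * t m)) * (1 - (1 + η)⁻¹)⁻¹)
        atTop (𝓝 (0 * (1 - (1 + η)⁻¹)⁻¹)) :=
      ((tendsto_const_nhds.div_atTop (htm.const_mul_atTop (by positivity)))).mul_const _
    rw [zero_mul] at h1
    simpa using ENNReal.tendsto_ofReal h1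
  refine eventually_whp_of_le hu ?_
  filter_upwards [eventually_gt_atTop 0, htm.eventually_gt_atTop 0] with m hm hcm
  have hc : 0 < (I₀ m).card := by
    rcases Nat.eq_zero_or_pos (I₀ m).card with h | h
    · simp [h] at hcm
    · exact h
  refine (measure_mono fun ω hω => ?_).trans
    ((hBI m hm).measure_grid_le hc (ht m hm).1 (lt_add_of_pos_right 1 hη0) hη0)
  by_contra hcon
  refine hω fun s hs => ?_
  refine (abs_countLE_sub_le (η := η) _ _ (ht m hm).1 hη0 (by linarith) hl (fun k hk => ?_)
    hs).trans ?_
  · by_contra! hk2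
    exact hcon ⟨k, hk, hk2.le⟩
  · have := hs.1
    have := (ht m hm).1
    have : 0 ≤ s := by linarith
    gcongr

/-- The law of large numbers along a random sequence of points in `[t m, lam]`. -/
theorem tendsto_countLE_div (hBI : ∀ m, 0 < m → BasicIndependence (P m) (p m) (I₀ m))
    (hlam0 : 0 < lam) (hlam1 : lam < 1) (ht : ∀ m, 0 < m → t m ∈ Set.Ioo 0 lam)
    (htm : Tendsto (fun m => ((I₀ m).card : ℝ) * t m) atTop atTop) {s : (Σ m, Ω m) → ℝ}
    (hs : ∀ᶠ z in whp P, s z ∈ Set.Icc (t z.1) lam) :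
    Tendsto (fun z => (countLE (fun i => p z.1 i z.2) (I₀ z.1) (s z) : ℝ)
      / ((I₀ z.1).card * s z)) (whp P) (𝓝 1) := by
  rw [Metric.tendsto_nhds]
  intro ε hε
  filter_upwards [hs, eventually_abs_countLE_sub_le hBI hlam0 hlam1 ht htm (half_pos hε),
    tendsto_fst_whp.eventually (eventually_gt_atTop 0),
    tendsto_fst_whp.eventually (htm.eventually_gt_atTop 0)] with z hsz hz hm hcm
  have ht0 := (ht z.1 hm).1
  have hc : 0 < ((I₀ z.1).card : ℝ) := pos_of_mul_pos_left hcm ht0.le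
  have hpos : 0 < (I₀ z.1).card * s z := mul_pos hc (ht0.trans_le hsz.1)
  have h1 := hz (s z) hsz
  rw [Real.dist_eq, div_sub_one hpos.ne', abs_div, abs_of_pos hpos, div_lt_iff₀ hpos]
  nlinarith

end Uniform

end StepUp

/-! ### The theorem -/

open StepUp in
theorem theorem5p3
    -- the multiple testing problems, one for each number `m ≥ 1` of hypotheses
    {Ω : ℕ → Type*} [∀ m, MeasurableSpace (Ω m)] (P : ∀ m, Measure (Ω m))
    [∀ m, IsProbabilityMeasure (P m)]
    (p : ∀ m, Fin m → Ω m → ℝ) (I₀ : ∀ m, Finset (Fin m))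
    (hBI : ∀ m, 0 < m → StepUp.BasicIndependence (P m) (p m) (I₀ m))
    -- the level, the tuning parameter and the estimators
    (α lam : ℝ) (hα0 : 0 < α) (hα1 : α < 1) (hαlam : α ≤ lam) (hlam1 : lam < 1)
    (est : ℕ → (Set.Ici lam → ℝ) → ℝ)
    (hest_meas : ∀ m, 0 < m → Measurable (est m))
    (hest_pos : ∀ m, 0 < m → ∀ ω, 0 < StepUp.mHat lam (est m) (fun i => p m i ω))
    -- `m₀ / m → κ₀ ∈ (0, 1]`
    (κ₀ : ℝ) (hκ₀ : κ₀ ∈ Set.Ioc (0 : ℝ) 1)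
    (hA1 : Tendsto (fun m : ℕ => ((I₀ m).card : ℝ) / (m : ℝ)) atTop (𝓝 κ₀))
    -- `m̂₀ ≤ K m` for some `K > 0`
    (hA3 : ∃ K : ℝ, 0 < K ∧ ∀ m : ℕ, 0 < m → ∀ ω,
      StepUp.mHat lam (est m) (fun i => p m i ω) ≤ K * (m : ℝ))
    -- `m̂₀ ≥ (C α / lam) max (R_m(lam), 1)` with probability tending to one, for some `C > 1`
    (hA4 : ∃ C : ℝ, 1 < C ∧ Tendsto (fun m => P m {ω |
      C * α / lam * max (StepUp.countLE (fun i => p m i ω) Finset.univ lam : ℝ) 1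
        ≤ StepUp.mHat lam (est m) (fun i => p m i ω)}) atTop (𝓝 1))
    -- `m̂₀ / m → C₀` in probability
    (C₀ : ℝ)
    (hC₀ : StepUp.TendstoInProb P
      (fun m ω => StepUp.mHat lam (est m) (fun i => p m i ω) / (m : ℝ)) C₀)
    -- the sequence `t_m`
    (δ : ℝ) (hδ : 0 < δ) (t : ℕ → ℝ) (ht : ∀ m, 0 < m → t m ∈ Set.Ioo 0 lam)
    (htm : Tendsto (fun m : ℕ => (m : ℝ) * t m) atTop atTop)
    (hF1 : Tendsto (fun m => P m {ω |
      δ - κ₀ + 1 / α * C₀ ≤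
        (((I₀ m)ᶜ.card : ℝ) / (m : ℝ)) *
          (StepUp.ecdf (fun i => p m i ω) (I₀ m)ᶜ (t m) / t m)}) atTop (𝓝 1)) :
    StepUp.TendstoInftyInProb P
        (fun m ω => (StepUp.V α lam (est m) (I₀ m) (fun i => p m i ω) : ℝ)) ∧
      StepUp.Consistent P p I₀ α lam est := by
  have hlam0 : 0 < lam := hα0.trans_le hαlam
  obtain ⟨C, hC1, hA4⟩ := hA4
  let x : ∀ z : Σ m, Ω m, Fin z.1 → ℝ := fun z i => p z.1 i z.2
  let M : (Σ m, Ω m) → ℝ := fun z => mHat lam (est z.1) (x z)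
  let s : (Σ m, Ω m) → ℝ := fun z => critVal α lam (M z) (R α lam (est z.1) (x z))
  have hm0 : ∀ᶠ z : Σ m, Ω m in whp P, 0 < z.1 := tendsto_fst_whp.eventually (eventually_gt_atTop 0)
  have hA1' : Tendsto (fun z : Σ m, Ω m => ((I₀ z.1).card : ℝ) / (z.1 : ℝ)) (whp P) (𝓝 κ₀) :=
    hA1.comp tendsto_fst_whp
  have hC₀' : Tendsto (fun z => M z / (z.1 : ℝ)) (whp P) (𝓝 C₀) := by
    rw [tendstoInProb_iff] at hC₀
    exact hC₀
  have hA4' : ∀ᶠ z in whp P, C * α / lam * max (countLE (x z) Finset.univ lam : ℝ) 1 ≤ M z := by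
    refine eventually_whp_of_tendsto_one (q := fun z =>
      C * α / lam * max (countLE (x z) Finset.univ lam : ℝ) 1 ≤ M z) ?_ hA4
    filter_upwards [eventually_gt_atTop 0] with m hm
    exact measurableSet_le_mHat (hBI m hm).measurable (hest_meas m hm) (C * α / lam)
  have hF1' : ∀ᶠ z in whp P, δ - κ₀ + 1 / α * C₀ ≤
      (((I₀ z.1)ᶜ.card : ℝ) / (z.1 : ℝ)) * (ecdf (x z) (I₀ z.1)ᶜ (t z.1) / t z.1) := by
    refine eventually_whp_of_tendsto_one (q := fun z => δ - κ₀ + 1 / α * C₀ ≤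
      (((I₀ z.1)ᶜ.card : ℝ) / (z.1 : ℝ)) * (ecdf (x z) (I₀ z.1)ᶜ (t z.1) / t z.1)) ?_ hF1
    filter_upwards [eventually_gt_atTop 0] with m hm
    exact measurableSet_le_ecdf (hBI m hm).measurable (I₀ m)ᶜ (δ - κ₀ + 1 / α * C₀)
      (((I₀ m)ᶜ.card : ℝ) / (m : ℝ)) (t m)
  have htn : Tendsto (fun m => ((I₀ m).card : ℝ) * t m) atTop atTop := by
    refine (hA1.pos_mul_atTop hκ₀.1 htm).congr' ?_
    filter_upwards [eventually_gt_atTop 0] with m hm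
    have : (m : ℝ) ≠ 0 := by positivity
    field_simp
  have hLLN := fun (u : (Σ m, Ω m) → ℝ) hu =>
    tendsto_countLE_div (P := P) (s := u) hBI hlam0 hlam1 ht htn hu
  have hn0 : ∀ᶠ z : Σ m, Ω m in whp P, 0 < ((I₀ z.1).card : ℝ) := by
    filter_upwards [hm0, tendsto_fst_whp.eventually (htn.eventually_gt_atTop 0)] with z hm hz
    exact pos_of_mul_pos_left hz (ht _ hm).1.le
  have hLt := hLLN (fun z => t z.1) (by
    filter_upwards [hm0] with z hm
    exact ⟨le_rfl, (ht _ hm).2.le⟩)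
  -- the threshold is at least `t m`
  have hts : ∀ᶠ z in whp P, t z.1 ≤ s z := by
    -- The true nulls' share minus the line tends to `κ₀ - C₀ / α`, so it eventually exceeds this
    -- limit minus `δ`; adding the bound `hF1'` makes the total positive.
    have h1 : Tendsto (fun z : Σ m, Ω m => ((I₀ z.1).card : ℝ) / (z.1 : ℝ) *
        ((countLE (x z) (I₀ z.1) (t z.1) : ℝ) / ((I₀ z.1).card * t z.1))
          - 1 / α * (M z / (z.1 : ℝ))) (whp P) (𝓝 (κ₀ * 1 - 1 / α * C₀)) :=
      (hA1'.mul hLt).sub (hC₀'.const_mul _)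
    filter_upwards [hm0, hn0, hF1', h1.eventually_const_lt
      (show κ₀ - 1 / α * C₀ - δ < κ₀ * 1 - 1 / α * C₀ by linarith)] with z hm hn hF hz
    have ht0 := (ht _ hm).1
    have hmR : (0 : ℝ) < z.1 := by exact_mod_cast hm
    refine le_critVal_R hα0.le (hest_pos _ hm _) ht0.le (ht _ hm).2.le ?_
    have e1 : ((I₀ z.1).card : ℝ) / (z.1 : ℝ) *
        ((countLE (x z) (I₀ z.1) (t z.1) : ℝ) / ((I₀ z.1).card * t z.1))
        = (countLE (x z) (I₀ z.1) (t z.1) : ℝ) / (z.1 * t z.1) := by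
      field_simp
    have e2 : (((I₀ z.1)ᶜ.card : ℝ) / (z.1 : ℝ)) * (ecdf (x z) (I₀ z.1)ᶜ (t z.1) / t z.1)
        = (countLE (x z) (I₀ z.1)ᶜ (t z.1) : ℝ) / (z.1 * t z.1) := by
      rw [div_mul_div_comm, card_mul_ecdf]
    rw [e1] at hz
    rw [e2] at hF
    have e3 : 1 / α * (M z / z.1) <
        (countLE (x z) (I₀ z.1) (t z.1) : ℝ) / (z.1 * t z.1)
        + (countLE (x z) (I₀ z.1)ᶜ (t z.1) : ℝ) / (z.1 * t z.1) := by linarith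
    rw [← add_div, ← Nat.cast_add, countLE_add_compl, div_mul_div_comm, one_mul,
      div_lt_div_iff₀ (by positivity) (by positivity)] at e3
    refine le_of_mul_le_mul_left ?_ hmR
    linarith
  have hsI : ∀ᶠ z in whp P, s z ∈ Set.Icc (t z.1) lam :=
    hts.mono fun z hz => ⟨hz, min_le_right _ _⟩
  have hLs := hLLN s hsI
  refine ⟨fun b => ?_, ?_⟩
  · refine tendsto_one_of_eventually_whp
      (q := fun z => b < (V α lam (est z.1) (I₀ z.1) (x z) : ℝ)) ?_
    filter_upwards [hm0, hts, hLt.eventually_const_lt (show (1 / 2 : ℝ) < 1 by norm_num),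
      tendsto_fst_whp.eventually (htn.eventually_gt_atTop (max 0 (2 * b)))] with z hm hz hL hb
    rw [lt_div_iff₀ ((le_max_left _ _).trans_lt hb)] at hL
    have : (countLE (x z) (I₀ z.1) (t z.1) : ℝ) ≤ V α lam (est z.1) (I₀ z.1) (x z) := by
      exact_mod_cast countLE_mono _ _ hz
    linarith [le_max_right 0 (2 * b)]
  -- the limit of `m̂₀ / m` is positive
  have hC₀pos : 0 < C₀ := by
    have hLl := hLLN (fun _ => lam) (by
      filter_upwards [hm0] with z hm
      exact ⟨(ht _ hm).2.le, le_rfl⟩)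
    -- By (A4), `m̂₀ / m` is at least `(C α / lam) (m₀/m) F̂₀(lam)`, which tends to `C α κ₀`.
    refine lt_of_lt_of_le (b := C * α * (κ₀ * 1)) (by have := hκ₀.1; positivity)
      (le_of_tendsto_of_tendsto ((hA1'.mul hLl).const_mul (C * α)) hC₀' ?_)
    filter_upwards [hm0, hn0, hA4'] with z hm hn hz
    have hmR : (0 : ℝ) < z.1 := by exact_mod_cast hm
    rw [le_div_iff₀ hmR]
    refine le_trans ?_ hz
    have e : C * α * (((I₀ z.1).card : ℝ) / (z.1 : ℝ) *
        ((countLE (x z) (I₀ z.1) lam : ℝ) / ((I₀ z.1).card * lam))) * z.1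
        = C * α / lam * countLE (x z) (I₀ z.1) lam := by
      field_simp
    rw [e]
    gcongr
    exact le_max_of_le_left (by exact_mod_cast countLE_le_univ _ _ _)
  have hFDP : Tendsto (fun z : Σ m, Ω m => FDP α lam (est z.1) (I₀ z.1) (x z)) (whp P)
      (𝓝 (α / C₀ * (κ₀ * 1))) := by
    refine ((tendsto_const_nhds.div hC₀' hC₀pos.ne').mul (hA1'.mul hLs)).congr' ?_
    filter_upwards [hm0, hn0, hA4', hsI] with z hm hn hz hsz
    have hmR : (0 : ℝ) < z.1 := by exact_mod_cast hm
    have hMz : 0 < M z := hest_pos _ hm _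
    have hs0 : 0 < s z := (ht _ hm).1.trans_le hsz.1
    rw [FDP_eq hα0 hMz (I₀ z.1) hs0 rfl (critVal_R_eq hα0 hlam0 hMz hC1 hz)]
    change α / (M z / z.1) * (((I₀ z.1).card : ℝ) / (z.1 : ℝ) *
      ((countLE (x z) (I₀ z.1) (s z) : ℝ) / ((I₀ z.1).card * s z)))
      = α / M z * ((countLE (x z) (I₀ z.1) (s z) : ℝ) / s z)
    field_simp
  have hE : Tendsto (fun m => ∫ ω, FDP α lam (est m) (I₀ m) (fun i => p m i ω) ∂(P m)) atTop
      (𝓝 (α / C₀ * (κ₀ * 1))) := by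
    refine tendsto_integral_of_tendsto_whp (b := 1)
      (X := fun m ω => FDP α lam (est m) (I₀ m) fun i => p m i ω) ?_ ?_ hFDP
    · filter_upwards [eventually_gt_atTop 0] with m hm
      exact measurable_FDP (hBI m hm).measurable (hest_meas m hm) hlam0.le _
    · filter_upwards [eventually_gt_atTop 0] with m hm ω
      rw [abs_of_nonneg (FDP_nonneg _)]
      exact FDP_le_one hα0.le hlam0.le (hest_pos m hm ω) _
  rw [Consistent, tendstoInProb_iff]
  simpa using hFDP.sub (hE.comp tendsto_fst_whp)
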